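/- **Definitions.** A convex $3$-polytope is the convex hull of finitely many points of $\mathbb{R}^3$ that has dimension $3$. A family of convex $3$-polytopes is *neighborly* if every two of its members have a $2$-dimensional intersection. Sets are *congruent* if an isometry of $\mathbb{R}^3$ maps one onto the other. For an integer $N\ge 3$ and $t\in\mathbb{Z}$ let $h_N(t)=\left(\tfrac{2\pi t}{N},\cos\tfrac{2\pi t}{N},\sin\tfrac{2\pi t}{N}\right)$, and let $V_N(t)$ be the Voronoi region of the point $h_N(t)$ with respect to the infinite set $\{h_N(k): k\in\mathbb{Z}\}$, that is, the set of points of $\mathbb{R}^3$ that are at least as close to $h_N(t)$ as to any other $h_N(k)$. Let $C_N(t)$ be the intersection of $V_N(t)$ with the halfspace $y\cos\tfrac{2\pi t}{N}+z\sin\tfrac{2\pi t}{N}\le N$, and let $D_N(t)$ be the union of $C_N(t)$ and the reflection of $C_N(t)$ across the bounding plane of this halfspace (the clipping plane). **Theorem.** For every positive integer $n$ there is a neighborly family of $n$ congruent convex $3$-polytopes, each with a plane of bilateral symmetry, a line of $180$-degree rotational symmetry, and a point of central symmetry. Explicitly, for all integers $N\ge 3$ with $n\le N+1$ and every integer $a$,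 the sets $D_N(a),D_N(a+1),\dots,D_N(a+n-1)$ form such a family. -/

import Mathlib

open Module

/-- Euclidean 3-space; the coordinates `x, y, z` of a point `p` are `p 0, p 1, p 2`. -/
abbrev E3 : Type := EuclideanSpace ℝ (Fin 3)

/-- The dimension of a set of points: the dimension of its affine span. (It is only ever asserted
to be 2 or 3; the empty set gets the value 0.) -/
noncomputable def setDim (A : Set E3) : ℕ := finrank ℝ (vectorSpan ℝ A)

/-- A convex 3-polytope: the convex hull of finitely many points, of dimension 3. -/
def IsConvexPolytope3 (A : Set E3) : Prop :=
  (∃ s : Finset E3, A = convexHull ℝ (s : Set E3)) ∧ setDim A = 3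

/-- A family of polytopes is neighborly if every two members have a 2-dimensional intersection. -/
def IsNeighborly {ι : Type*} (P : ι → Set E3) : Prop :=
  ∀ i j, i ≠ j → setDim (P i ∩ P j) = 2

/-- Two sets are congruent if an isometry of space carries one onto the other. -/
def AreCongruent (A B : Set E3) : Prop :=
  ∃ g : E3 ≃ᵃⁱ[ℝ] E3, g '' A = B

/-- `A` is invariant under the orthogonal reflection in the nonempty affine subspace `S`. -/
def IsSymmetricAbout (A : Set E3) (S : AffineSubspace ℝ E3) [Nonempty S] : Prop :=
  EuclideanGeometry.reflection S '' A = A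

/-- `A` has a plane of bilateral symmetry. -/
def HasSymmetryPlane (A : Set E3) : Prop :=
  ∃ (S : AffineSubspace ℝ E3) (_ : Nonempty S), finrank ℝ S.direction = 2 ∧ IsSymmetricAbout A S

/-- `A` has a line of 180-degree rotational symmetry: the rotation of 3-space by 180 degrees about
a line is the orthogonal reflection in that line. -/
def HasHalfTurnAxis (A : Set E3) : Prop :=
  ∃ (S : AffineSubspace ℝ E3) (_ : Nonempty S), finrank ℝ S.direction = 1 ∧ IsSymmetricAbout A S

/-- `A` has a point of central symmetry. -/
def HasSymmetryCenter (A : Set E3) : Prop :=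
  ∃ c : E3, AffineIsometryEquiv.pointReflection ℝ c '' A = A

/-- A neighborly family of congruent convex 3-polytopes, each of which has a plane of bilateral
symmetry, a line of 180-degree rotational symmetry and a point of central symmetry. -/
structure IsSymmetricNeighborlyFamily {ι : Type*} (P : ι → Set E3) : Prop where
  polytope : ∀ i, IsConvexPolytope3 (P i)
  neighborly : IsNeighborly P
  congruent : ∀ i j, AreCongruent (P i) (P j)
  plane : ∀ i, HasSymmetryPlane (P i)
  axis : ∀ i, HasHalfTurnAxis (P i)
  center : ∀ i, HasSymmetryCenter (P i)

/-- The regular circular helix `h(t) = (t, cos t, sin t)`. -/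
noncomputable def helix (t : ℝ) : E3 := !₂[t, Real.cos t, Real.sin t]

/-- The points `h(2πt/N)`, evenly spaced on the helix, `N` to a turn. -/
noncomputable def helixPoint (N : ℕ) (t : ℤ) : E3 := helix (2 * Real.pi * t / N)

/-- The Voronoi region of the site `p` with respect to the set of sites `X`. -/
def voronoiRegion (X : Set E3) (p : E3) : Set E3 := {q | ∀ x ∈ X, dist q p ≤ dist q x}

/-- The Voronoi region of `h(2πt/N)` with respect to all the points `h(2πk/N)`, `k ∈ ℤ`. -/
noncomputable def helixRegion (N : ℕ) (t : ℤ) : Set E3 :=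
  voronoiRegion (Set.range (helixPoint N)) (helixPoint N t)

/-- The unit vector orthogonal to the axis of the helix that points towards `h(2πt/N)`. -/
noncomputable def radialDir (N : ℕ) (t : ℤ) : E3 :=
  !₂[0, Real.cos (2 * Real.pi * t / N), Real.sin (2 * Real.pi * t / N)]

/-- The clipping halfspace `y cos (2πt/N) + z sin (2πt/N) ≤ N`. -/
def clippingHalfspace (N : ℕ) (t : ℤ) : Set E3 :=
  {p | p 1 * Real.cos (2 * Real.pi * t / N) + p 2 * Real.sin (2 * Real.pi * t / N) ≤ N}

/-- The clipping plane, given by a point and its direction; its equation is proved below. -/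
noncomputable def clippingPlane (N : ℕ) (t : ℤ) : AffineSubspace ℝ E3 :=
  AffineSubspace.mk' ((N : ℝ) • radialDir N t) (Submodule.span ℝ {radialDir N t})ᗮ

noncomputable instance instNonemptyClippingPlane (N : ℕ) (t : ℤ) : Nonempty (clippingPlane N t) :=
  inferInstanceAs (Nonempty (AffineSubspace.mk' _ _))

/-- The clipping plane is `y cos (2πt/N) + z sin (2πt/N) = N`, the boundary of the halfspace. -/
theorem mem_clippingPlane_iff (N : ℕ) (t : ℤ) (p : E3) : p ∈ clippingPlane N t ↔
    p 1 * Real.cos (2 * Real.pi * t / N) + p 2 * Real.sin (2 * Real.pi * t / N) = N := by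
  have h := Real.cos_sq_add_sin_sq (2 * Real.pi * t / N)
  rw [clippingPlane, AffineSubspace.mem_mk', Submodule.mem_orthogonal_singleton_iff_inner_right]
  simp only [radialDir, vsub_eq_sub, PiLp.inner_apply, Fin.sum_univ_three]
  simp
  constructor <;> intro h'
  · linear_combination h' + N * h
  · linear_combination h' - N * h

/-- The Voronoi region of `h(2πt/N)`, clipped by its halfspace. -/
noncomputable def clippedRegion (N : ℕ) (t : ℤ) : Set E3 :=
  helixRegion N t ∩ clippingHalfspace N t

/-- The union of the clipped Voronoi region and its reflection across the clipping plane. -/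
noncomputable def doubledRegion (N : ℕ) (t : ℤ) : Set E3 :=
  clippedRegion N t ∪ EuclideanGeometry.reflection (clippingPlane N t) '' clippedRegion N t

/-! ### Trigonometric inequalities -/

/-! Take two sites whose angles differ by `2α = 2πm/N` with `0 < m ≤ N`, and a point at the middle
angle, at distance `r` from the axis on the far side. Its squared distance to a site at relative
angle `u` is `u² + 2r cos u + 1 + r²`. If `m < N`, then `r = α / sin α` makes `±α` critical points
of this function, and they are its only global minima (`mul_mul_sin_lt`). If `m = N`, then `α = π`
and no such `r` exists, but only the discrete angles of actual sites compete, and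
`mul_sub_lt_mul_sin_sq` leaves room for some `r < N`. In both cases `exists_radius_gap` puts the
point strictly inside both clipping halfspaces and strictly closer to the two sites than to any
other. Near it the two regions therefore share a piece of the perpendicular bisector.

In coordinates at its site, a Voronoi region is closed under moving radially outward
(`InCell.mono`). Hence the union of the clipped region with its mirror image equals the intersection
of the whole Voronoi region with its mirror image (`mem_doubledRegion_iff`). This makes the doubled
region convex, and a few constraints bound it, so only finitely many of them matter and it is a
polytope. The mirror plane is one symmetry, the half-turn about the radial line through the site is
another, and their composite is the central one. Screw motions of the helix give the congruences. -/

theorem mul_cos_lt_sin {x : ℝ} (hx : 0 < x) (hx' : x < Real.pi) : x * Real.cos x < Real.sin x := by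
  have hs := Real.sin_pos_of_pos_of_lt_pi hx hx'
  rcases lt_or_ge x (Real.pi / 2) with h | h
  · have hc : 0 < Real.cos x := Real.cos_pos_of_mem_Ioo ⟨by linarith, h⟩
    have ht := Real.lt_tan hx h
    rwa [Real.tan_eq_sin_div_cos, lt_div_iff₀ hc] at ht
  · have hc : Real.cos x ≤ 0 := Real.cos_nonpos_of_pi_div_two_le_of_le h (by linarith)
    nlinarith

theorem mul_sin_le_mul_sin {x y : ℝ} (hx : 0 < x) (hxy : x ≤ y) (hy : y ≤ Real.pi) :
    x * Real.sin y ≤ y * Real.sin x := by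
  have hy0 : 0 < y := hx.trans_le hxy
  have h := strictConcaveOn_sin_Icc.concaveOn.2 (Set.mem_Icc.2 ⟨hy0.le, hy⟩)
    (Set.left_mem_Icc.2 Real.pi_pos.le) (div_nonneg hx.le hy0.le)
    (sub_nonneg.2 ((div_le_one hy0).2 hxy)) (add_sub_cancel _ _)
  simp only [smul_eq_mul, Real.sin_zero, mul_zero, add_zero] at h
  rw [div_mul_cancel₀ _ hy0.ne', div_mul_eq_mul_div, div_le_iff₀ hy0] at h
  linarith

theorem mul_mul_sin_lt_of_lt {α a : ℝ} (hα' : α < Real.pi) (ha : 0 < a)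
    (haα : a < α) : a * (α - a) * Real.sin α < α * Real.sin a * Real.sin (α - a) := by
  obtain ⟨b, rfl⟩ : ∃ b, α = a + b := ⟨α - a, by ring⟩
  have hb : 0 < b := by linarith
  have hsa := Real.sin_pos_of_pos_of_lt_pi ha (by linarith)
  have hsb := Real.sin_pos_of_pos_of_lt_pi hb (by linarith)
  have h1 := mul_lt_mul_of_pos_left (mul_cos_lt_sin hb (by linarith)) (mul_pos ha hsa)
  have h2 := mul_lt_mul_of_pos_left (mul_cos_lt_sin ha (by linarith)) (mul_pos hb hsb)
  rw [add_sub_cancel_left, Real.sin_add]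
  nlinarith

/-- With `a = α + b` both sides are negated. Below `π` the monotonicity of `sin x / x` suffices;
while `b ≤ π ≤ α + b` the product of sines is not positive; beyond that the product is at most `cos²
(α/2)` while `(α + b) * b` exceeds `1`. -/
theorem mul_mul_sin_lt_of_gt {α a : ℝ} (hα : 0 < α) (hα' : α < Real.pi) (haα : α < a) :
    a * (α - a) * Real.sin α < α * Real.sin a * Real.sin (α - a) := by
  obtain ⟨b, rfl⟩ : ∃ b, a = α + b := ⟨a - α, by ring⟩
  have hb : 0 < b := by linarith
  have hs := Real.sin_pos_of_pos_of_lt_pi hα hα'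
  have hab : 0 < (α + b) * b * Real.sin α := by positivity
  suffices h : α * Real.sin (α + b) * Real.sin b < (α + b) * b * Real.sin α by
    rw [show α - (α + b) = -b by ring, Real.sin_neg]
    linarith
  rcases lt_or_ge (α + b) Real.pi with h | h
  · have h1 := mul_sin_le_mul_sin hα haα.le h.le
    have h2 := Real.sin_lt hb
    have h3 := Real.sin_pos_of_pos_of_lt_pi hb (by linarith)
    calc α * Real.sin (α + b) * Real.sin b ≤ (α + b) * Real.sin α * Real.sin b := by gcongr
      _ < (α + b) * Real.sin α * b := by gcongr
      _ = _ := by ring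
  rcases le_or_gt b Real.pi with h' | h'
  · have h1 : Real.sin (α + b) ≤ 0 := by
      have := Real.sin_nonneg_of_nonneg_of_le_pi (x := α + b - Real.pi) (by linarith) (by linarith)
      rw [Real.sin_sub_pi] at this
      linarith
    have h2 := Real.sin_nonneg_of_nonneg_of_le_pi hb.le h'
    have := mul_nonneg (mul_nonneg hα.le (neg_nonneg.2 h1)) h2
    linarith
  · have hp := Real.pi_gt_three
    have hhalf := mul_cos_lt_sin (x := α / 2) (by linarith) (by linarith)
    have hc : 0 < Real.cos (α / 2) := Real.cos_pos_of_mem_Ioo ⟨by linarith, by linarith⟩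
    have hprod : Real.sin (α + b) * Real.sin b ≤ Real.cos (α / 2) ^ 2 := by
      have e1 := Real.cos_add (α + b) b
      have e2 := Real.cos_sub (α + b) b
      rw [add_sub_cancel_right] at e2
      have e3 := Real.cos_sq (α / 2)
      rw [show 2 * (α / 2) = α by ring] at e3
      have := Real.neg_one_le_cos (α + b + b)
      linarith
    have hsin : Real.sin α = 2 * Real.sin (α / 2) * Real.cos (α / 2) := by
      rw [← Real.sin_two_mul]; ring_nf
    calc α * Real.sin (α + b) * Real.sin b = α * (Real.sin (α + b) * Real.sin b) := by ring
      _ ≤ α * Real.cos (α / 2) ^ 2 := by gcongr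
      _ = 2 * (α / 2 * Real.cos (α / 2)) * Real.cos (α / 2) := by ring
      _ < 2 * Real.sin (α / 2) * Real.cos (α / 2) := by gcongr
      _ = 1 * Real.sin α := by rw [hsin]; ring
      _ ≤ _ := by gcongr; nlinarith

theorem mul_mul_sin_lt {α a : ℝ} (hα : 0 < α) (hα' : α < Real.pi) (ha : a ≠ 0) (haα : a ≠ α) :
    a * (α - a) * Real.sin α < α * Real.sin a * Real.sin (α - a) := by
  rcases lt_or_gt_of_ne haα with h | h
  · rcases lt_or_gt_of_ne ha with h' | h'
    -- The inequality is invariant under `a ↦ α - a`, which carries `a < 0` to `a > α`.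
    · have := mul_mul_sin_lt_of_gt hα hα' (a := α - a) (by linarith)
      rw [sub_sub_cancel] at this
      linarith
    · exact mul_mul_sin_lt_of_lt hα' h' h
  · exact mul_mul_sin_lt_of_gt hα hα' h

theorem sq_mul_one_sub_lt_sin_sq {v : ℝ} (hv : 0 < v) (hv' : v ≤ 1) :
    v ^ 2 * (1 - v ^ 2 / 3) < Real.sin v ^ 2 := by
  have h := Real.sin_gt_sub_cube hv
  have h0 : 0 < v - v ^ 3 / 6 := by nlinarith [pow_le_one₀ (n := 2) hv.le hv']
  have h1 : (v - v ^ 3 / 6) ^ 2 < Real.sin v ^ 2 := by gcongr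
  nlinarith [pow_pos hv 6]

theorem mul_sub_lt_mul_sin_sq_of_two_mul_le {N j : ℕ} (hN : 3 ≤ N) (hj : 0 < j) (hjN : 2 * j ≤ N) :
    Real.pi * j / N * (Real.pi - Real.pi * j / N) < N * Real.sin (Real.pi * j / N) ^ 2 := by
  have hp := Real.pi_gt_three
  have hp' := Real.pi_lt_d2
  have hN0 : (3 : ℝ) ≤ N := by exact_mod_cast hN
  have hj0 : (1 : ℝ) ≤ j := by exact_mod_cast hj
  have hjN' : 2 * (j : ℝ) ≤ N := by exact_mod_cast hjN
  set v := Real.pi * j / N with hv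
  have hNv : N * v = Real.pi * j := by rw [hv]; field_simp
  have hv0 : 0 < v := by positivity
  have hv2 : v ≤ Real.pi / 2 := by
    rw [hv, div_le_iff₀ (by linarith)]
    nlinarith
  -- Multiplying by `v` and using `N * v = π * j` eliminates `N`.
  suffices h : v ^ 2 * (Real.pi - v) < Real.pi * j * Real.sin v ^ 2 by
    rw [← hNv] at h
    have : v * (v * (Real.pi - v)) < v * (N * Real.sin v ^ 2) := by linarith
    exact lt_of_mul_lt_mul_left this hv0.le
  rcases Nat.lt_or_ge j 2 with h | h
  · have hj1 : j = 1 := by omega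
    subst hj1
    rw [Nat.cast_one, mul_one] at hNv ⊢
    rcases Nat.lt_or_ge N 4 with h4 | h4
    -- For `j = 1`, only `N = 3` gives `v > 1`, out of reach of the cubic bound; here the claim is
    -- `π² < 81/8`.
    · have hN3 : N = 3 := by omega
      have : v = Real.pi / 3 := by subst hN3; push_cast at hNv; linarith
      rw [this, Real.sin_pi_div_three, div_pow √3, Real.sq_sqrt (by norm_num)]
      have : Real.pi * Real.pi ^ 2 < Real.pi * (81 / 8) := by gcongr; nlinarith
      nlinarith
    · have h4' : (4 : ℝ) ≤ N := by exact_mod_cast h4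
      have hv4 : v ≤ Real.pi / 4 := by nlinarith
      have := sq_mul_one_sub_lt_sin_sq hv0 (by linarith)
      have h1 : v ^ 2 * (Real.pi - v) ≤ Real.pi * (v ^ 2 * (1 - v ^ 2 / 3)) := by
        have : 0 ≤ v ^ 2 * v * (3 - Real.pi * v) := mul_nonneg (by positivity) (by nlinarith)
        nlinarith
      exact h1.trans_lt (by gcongr)
  · have hj2 : (2 : ℝ) ≤ j := by exact_mod_cast h
    have hstep : Real.pi * 2 * Real.sin v ^ 2 ≤ Real.pi * j * Real.sin v ^ 2 := by gcongr
    refine lt_of_lt_of_le ?_ hstep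
    rcases le_or_gt v 1 with hv1 | hv1
    · have := sq_mul_one_sub_lt_sin_sq hv0 hv1
      have h1 : v ^ 2 * (Real.pi - v) ≤ Real.pi * 2 * (v ^ 2 * (1 - v ^ 2 / 3)) := by
        have h3 : v ^ 2 ≤ 1 := by nlinarith
        have : 0 ≤ v ^ 2 * (Real.pi * (1 - 2 * v ^ 2 / 3) + v) :=
          mul_nonneg (by positivity) (by nlinarith)
        nlinarith
      exact h1.trans_lt (by gcongr)
    -- Jordan's inequality `sin v ≥ 2v/π` reduces the claim to `π - v < 8/π`, true for `v > 1`.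
    · have hs := Real.mul_le_sin hv0.le hv2
      have hs2 : (2 / Real.pi * v) ^ 2 ≤ Real.sin v ^ 2 := by gcongr
      refine lt_of_lt_of_le ?_ (mul_le_mul_of_nonneg_left hs2 (by positivity))
      have : Real.pi * 2 * (2 / Real.pi * v) ^ 2 = v ^ 2 * (8 / Real.pi) := by field_simp; ring
      rw [this]
      gcongr
      rw [lt_div_iff₀ (by linarith)]
      nlinarith

theorem mul_sub_lt_mul_sin_sq {N j : ℕ} (hN : 3 ≤ N) (hj : 0 < j) (hjN : j < N) :
    Real.pi * j / N * (Real.pi - Real.pi * j / N) < N * Real.sin (Real.pi * j / N) ^ 2 := by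
  rcases le_or_gt (2 * j) N with h | h
  · exact mul_sub_lt_mul_sin_sq_of_two_mul_le hN hj h
  · have := mul_sub_lt_mul_sin_sq_of_two_mul_le hN (j := N - j) (by omega) (by omega)
    have hN0 : (N : ℝ) ≠ 0 := by positivity
    have e : Real.pi * ((N - j : ℕ) : ℝ) / N = Real.pi - Real.pi * j / N := by
      rw [Nat.cast_sub hjN.le]; field_simp
    rw [e, Real.sin_pi_sub, sub_sub_cancel] at this
    linarith

/-- Among the points of the helix `N` to a turn, the two at angles `±πm/N` from the centre are
strictly closest to a point of the central perpendicular, at distance `r` beyond the axis. -/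
theorem exists_radius_gap {N m : ℕ} (hN : 3 ≤ N) (hm : 0 < m) (hmN : m ≤ N) :
    ∃ r : ℝ, -r * Real.cos (Real.pi * m / N) < N ∧ ∀ j : ℤ, j ≠ 0 → j ≠ m →
      (Real.pi * m / N) ^ 2 + 2 * r * Real.cos (Real.pi * m / N) <
        (Real.pi * m / N - 2 * Real.pi * j / N) ^ 2 +
          2 * r * Real.cos (Real.pi * m / N - 2 * Real.pi * j / N) := by
  have hp := Real.pi_gt_three
  have hN0 : (0 : ℝ) < N := by positivity
  have hm0 : (0 : ℝ) < m := by positivity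
  rcases hmN.lt_or_eq with hlt | rfl
  · set α := Real.pi * m / N with hα
    have hNα : N * α = Real.pi * m := by rw [hα]; field_simp
    have hlt' : (m : ℝ) + 1 ≤ N := by exact_mod_cast hlt
    have hα0 : 0 < α := by positivity
    have hαπ : α < Real.pi := by
      rw [hα, div_lt_iff₀ hN0]; nlinarith
    have hs := Real.sin_pos_of_pos_of_lt_pi hα0 hαπ
    -- The derivative of `u² + 2r cos u` vanishes at `u = α` exactly for this `r`.
    refine ⟨α / Real.sin α, ?_, fun j hj hjm => ?_⟩
    · have h1 := mul_cos_lt_sin (x := Real.pi - α) (by linarith) (by linarith)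
      rw [Real.cos_pi_sub, Real.sin_pi_sub] at h1
      rw [neg_mul, div_mul_eq_mul_div, ← neg_div, div_lt_iff₀ hs]
      rcases le_or_gt 0 (Real.cos α) with hc | hc
      · have := mul_nonneg hα0.le hc
        nlinarith [mul_pos hN0 hs]
      -- Here `N * (π - α) = π * (N - m) ≥ π > α`, because `m < N`.
      · have : α * -Real.cos α ≤ N * (Real.pi - α) * -Real.cos α := by
          gcongr
          · linarith
          · nlinarith
        nlinarith
    · have key := mul_mul_sin_lt hα0 hαπ (a := Real.pi * j / N)
        (by have : (j : ℝ) ≠ 0 := by exact_mod_cast hj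
            positivity)
        (by rw [hα]
            intro h
            field_simp at h
            exact hjm (by exact_mod_cast h))
      set a := Real.pi * j / N with ha
      have e : α - 2 * Real.pi * j / N = α - 2 * a := by rw [ha]; ring
      have e2 := Real.cos_sub_cos (α - 2 * a) α
      rw [show (α - 2 * a + α) / 2 = α - a by ring, show (α - 2 * a - α) / 2 = -a by ring,
        Real.sin_neg] at e2
      rw [e, show Real.cos (α - 2 * a) = Real.cos α + 2 * (Real.sin (α - a) * Real.sin a) by linarith]
      have : a * (α - a) < α / Real.sin α * (Real.sin a * Real.sin (α - a)) := by
        rw [div_mul_eq_mul_div α, lt_div_iff₀ hs]; linarith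
      linarith
  -- At `α = π` the clipping condition reads `r < N`. The finitely many strict inequalities for `0 <
  -- j < N` hold at `r = N`, so they persist for `r` slightly smaller.
  · have hfin : ∀ᶠ r in nhdsWithin (m : ℝ) (Set.Iio (m : ℝ)), ∀ j ∈ Finset.Ioo 0 m,
        Real.pi * j / m * (Real.pi - Real.pi * j / m) < r * Real.sin (Real.pi * j / m) ^ 2 := by
      rw [Filter.eventually_all_finset]
      intro j hj
      rw [Finset.mem_Ioo] at hj
      have hc : Continuous fun r : ℝ => r * Real.sin (Real.pi * j / m) ^ 2 := by fun_prop
      exact (hc.continuousAt.eventually_const_lt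
        (mul_sub_lt_mul_sin_sq hN hj.1 hj.2)).filter_mono nhdsWithin_le_nhds
    have hlt : ∀ᶠ r in nhdsWithin (m : ℝ) (Set.Iio (m : ℝ)), r < (m : ℝ) ∧ 0 < r :=
      (eventually_mem_nhdsWithin).and
        ((eventually_gt_nhds hN0).filter_mono nhdsWithin_le_nhds)
    obtain ⟨r, hr, hrm, hr0⟩ := (hfin.and hlt).exists
    have e : Real.pi * m / m = Real.pi := by field_simp
    refine ⟨r, by rw [e, Real.cos_pi]; linarith, fun j hj hjm => ?_⟩
    rw [e, Real.cos_pi, Real.cos_pi_sub]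
    set a := Real.pi * j / m with ha
    have e : 2 * Real.pi * j / m = 2 * a := by rw [ha]; ring
    rw [e, Real.cos_two_mul']
    have hcs := Real.sin_sq_add_cos_sq a
    suffices a * (Real.pi - a) < r * Real.sin a ^ 2 by nlinarith
    by_cases hj' : 0 < j ∧ j < m
    · obtain ⟨i, rfl⟩ := Int.eq_ofNat_of_zero_le hj'.1.le
      have := hr i (by rw [Finset.mem_Ioo]; omega)
      rwa [ha]
    -- For the remaining `j`, `a` lies outside `[0, π]`, so `a * (π - a)` is negative.
    · have h0 : 0 ≤ r * Real.sin a ^ 2 := by positivity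
      refine lt_of_lt_of_le ?_ h0
      have hma : m * a = Real.pi * j := by rw [ha]; field_simp
      rcases lt_or_gt_of_ne hj with h | h
      · have : (j : ℝ) < 0 := by exact_mod_cast h
        have ha0 : a < 0 := by nlinarith
        nlinarith
      · have : (m : ℝ) < j := by
          have : (m : ℤ) < j := by omega
          exact_mod_cast this
        have ha0 : Real.pi < a := by
          rw [ha, lt_div_iff₀ hN0]; nlinarith
        nlinarith

/-! ### Compact finite intersections of halfspaces are polytopes -/

section Polytope

variable {E : Type*} [NormedAddCommGroup E] [InnerProductSpace ℝ E]

/-- The points at least as close to `p.1` as to `p.2`, for all pairs `p` in `T`. -/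
def closerSet (T : Set (E × E)) : Set E := {q | ∀ p ∈ T, dist q p.1 ≤ dist q p.2}

/-- The quadratic terms cancel, so each constraint of a `closerSet` is affine along lines and
defines a halfspace when its two points differ. -/
theorem dist_sq_sub_dist_sq_add_smul (a b q v : E) (ε : ℝ) :
    dist (q + ε • v) a ^ 2 - dist (q + ε • v) b ^ 2 =
      dist q a ^ 2 - dist q b ^ 2 + 2 * ε * inner ℝ v (b - a) := by
  have h (c : E) : dist (q + ε • v) c ^ 2 =
      dist q c ^ 2 + 2 * (ε * inner ℝ v (q - c)) + ‖ε • v‖ ^ 2 := by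
    rw [dist_eq_norm, dist_eq_norm, add_sub_right_comm, norm_add_sq_real, inner_smul_right,
      real_inner_comm]
  rw [h, h, show b - a = q - a - (q - b) by abel, inner_sub_right v (q - a) (q - b)]
  ring

theorem dist_le_dist_iff_sq_sub_sq {E : Type*} [PseudoMetricSpace E] {a b q : E} :
    dist q a ≤ dist q b ↔ dist q a ^ 2 - dist q b ^ 2 ≤ 0 := by
  rw [sub_nonpos, sq_le_sq₀ dist_nonneg dist_nonneg]

theorem convex_closerSet (T : Set (E × E)) : Convex ℝ (closerSet T) := by
  intro x hx y hy s t hs ht hst p hp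
  have h1 := dist_sq_sub_dist_sq_add_smul p.1 p.2 x (y - x) t
  have h2 := dist_sq_sub_dist_sq_add_smul p.1 p.2 x (y - x) 1
  have hx' := dist_le_dist_iff_sq_sub_sq.1 (hx p hp)
  have hy' := dist_le_dist_iff_sq_sub_sq.1 (hy p hp)
  have e : s • x + t • y = x + t • (y - x) := by
    rw [show s = 1 - t by linarith]; module
  rw [one_smul, add_sub_cancel] at h2
  rw [e, dist_le_dist_iff_sq_sub_sq, h1]
  nlinarith

theorem isClosed_closerSet {E : Type*} [NormedAddCommGroup E] (T : Set (E × E)) : IsClosed (closerSet T) := by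
  simp only [closerSet, Set.ofPred_forall]
  exact isClosed_biInter fun p _ => isClosed_le (by fun_prop) (by fun_prop)

/-- An extreme point is determined by its set of active constraints. If `x` and `y` have the same
active set, the segment from `y` to `x` can be prolonged slightly past `x` inside the set, so
extremality forces `x = y`. -/
theorem finite_extremePoints_closerSet {T : Set (E × E)} (hT : T.Finite) :
    ((closerSet T).extremePoints ℝ).Finite := by
  refine Set.Finite.of_finite_image (f := fun x => {p ∈ T | dist x p.1 = dist x p.2})
    (hT.finite_subsets.subset ?_) ?_
  · rintro _ ⟨x, -, rfl⟩
    exact Set.sep_subset _ _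
  intro x hx y hy hxy
  have hev : ∀ᶠ ε in nhdsWithin (0 : ℝ) (Set.Ioi 0), ∀ p ∈ T,
      dist (x + ε • (x - y)) p.1 ≤ dist (x + ε • (x - y)) p.2 := by
    rw [Filter.eventually_all_finite hT]
    intro p hp
    rcases (hx.1 p hp).eq_or_lt with h | h
    · have hy' : dist y p.1 = dist y p.2 := by
        have hmem : p ∈ {p ∈ T | dist y p.1 = dist y p.2} := by
          rw [← show _ = {p ∈ T | dist y p.1 = dist y p.2} from hxy]
          exact ⟨hp, h⟩
        exact hmem.2
      refine Filter.Eventually.of_forall fun ε => ?_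
      have h1 := dist_sq_sub_dist_sq_add_smul p.1 p.2 x (x - y) ε
      have h2 := dist_sq_sub_dist_sq_add_smul p.1 p.2 x (x - y) (-1)
      rw [show x + (-1 : ℝ) • (x - y) = y by module, hy', h, sub_self, sub_self] at h2
      rw [dist_le_dist_iff_sq_sub_sq, h1, h, show inner ℝ (x - y) (p.2 - p.1) = (0 : ℝ) by linarith]
      simp
    · have hc : ContinuousAt (fun ε : ℝ => dist (x + ε • (x - y)) p.1 -
          dist (x + ε • (x - y)) p.2) 0 := by fun_prop
      have h0 := hc.eventually_lt_const (u := 0) (by simpa using h)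
      filter_upwards [h0.filter_mono nhdsWithin_le_nhds] with ε hε
      linarith
  obtain ⟨ε, hε, hε0⟩ := (hev.and eventually_mem_nhdsWithin).exists
  rw [Set.mem_Ioi] at hε0
  refine (hx.2 hy.1 hε ⟨ε / (1 + ε), 1 / (1 + ε), by positivity, by positivity, by field_simp; ring,
    ?_⟩).symm
  have h1 : (1 + ε) ≠ 0 := by positivity
  have h2 : 1 / (1 + ε) + ε / (1 + ε) = 1 := by field_simp
  calc (ε / (1 + ε)) • y + (1 / (1 + ε)) • (x + ε • (x - y))
      = (1 / (1 + ε) + ε / (1 + ε)) • x := by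
        rw [show ε / (1 + ε) = ε * (1 / (1 + ε)) by ring]; module
    _ = x := by rw [h2, one_smul]

theorem exists_finset_closerSet_eq_convexHull [FiniteDimensional ℝ E] {T : Set (E × E)}
    (hT : T.Finite) (hb : Bornology.IsBounded (closerSet T)) :
    ∃ s : Finset E, closerSet T = convexHull ℝ (s : Set E) := by
  have hfin := finite_extremePoints_closerSet hT
  have := FiniteDimensional.proper_real E
  refine ⟨hfin.toFinset, ?_⟩
  rw [hfin.coe_toFinset, ← (hfin.isClosed_convexHull ℝ).closure_eq]
  -- Krein–Milman; the hull of finitely many points is already closed.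
  exact (closure_convexHull_extremePoints (Metric.isCompact_of_isClosed_isBounded
    (isClosed_closerSet T) hb) (convex_closerSet T)).symm

end Polytope

/-! ### Dimension -/

theorem setDim_eq_three_of_mem_nhds {A : Set E3} {p : E3} (h : A ∈ nhds p) : setDim A = 3 := by
  have := affineSpan_eq_top_of_nonempty_interior (s := A)
    ⟨p, interior_mono (subset_convexHull ℝ A) (mem_interior_iff_mem_nhds.2 h)⟩
  rw [setDim, ← direction_affineSpan, this, AffineSubspace.direction_top, finrank_top,
    finrank_euclideanSpace, Fintype.card_fin]

/-- A set in the perpendicular bisector of two distinct points which contains all points of the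
bisector close to one of them has dimension two. -/
theorem setDim_eq_two_of_perpBisector {A : Set E3} {a b p : E3} (hab : a ≠ b)
    (hA : ∀ q ∈ A, dist q a = dist q b) (hp : dist p a = dist p b)
    (h : ∀ᶠ q in nhds p, dist q a = dist q b → q ∈ A) : setDim A = 2 := by
  have hdir : finrank ℝ (AffineSubspace.perpBisector a b).direction = 2 := by
    have : Fact (finrank ℝ E3 = 2 + 1) := ⟨by simp⟩
    rw [AffineSubspace.direction_perpBisector]
    exact Submodule.finrank_orthogonal_span_singleton (n := 2) (vsub_ne_zero.2 hab.symm)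
  rw [setDim, ← hdir]
  refine congrArg (fun W : Submodule ℝ E3 => finrank ℝ W) (le_antisymm ?_ ?_)
  · have hsub : A ⊆ AffineSubspace.perpBisector a b := fun q hq =>
      AffineSubspace.mem_perpBisector_iff_dist_eq.2 (hA q hq)
    exact vectorSpan_mono ℝ hsub
  · intro v hv
    have hpA : p ∈ A := h.self_of_nhds hp
    have hc : ContinuousAt (fun ε : ℝ => p + ε • v) 0 := by fun_prop
    have hc' : Filter.Tendsto (fun ε : ℝ => p + ε • v) (nhdsWithin 0 {0}ᶜ) (nhds p) := by
      have := hc.tendsto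
      simp only [zero_smul, add_zero] at this
      exact this.mono_left nhdsWithin_le_nhds
    obtain ⟨ε, hε, hε0⟩ := ((hc'.eventually h).and eventually_mem_nhdsWithin).exists
    have hmem : p + ε • v ∈ A := by
      apply hε
      rw [← AffineSubspace.mem_perpBisector_iff_dist_eq] at hp ⊢
      have := AffineSubspace.vadd_mem_of_mem_direction
        (Submodule.smul_mem _ ε hv) hp
      rwa [vadd_eq_add, add_comm] at this
    have := vsub_mem_vectorSpan ℝ hmem hpA
    rw [vsub_eq_sub, add_sub_cancel_left] at this
    exact (Submodule.smul_mem_iff _ hε0).1 this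

/-! ### Reflections -/

theorem reflection_eq_of_midpoint {S : AffineSubspace ℝ E3} [Nonempty S] {q m : E3} (hm : m ∈ S)
    (h : q - m ∈ S.directionᗮ) : EuclideanGeometry.reflection S q = m + m - q := by
  have := EuclideanGeometry.reflection_orthogonal_vadd hm h
  rw [vadd_eq_add, sub_add_cancel] at this
  rw [this, vadd_eq_add]
  abel

theorem image_eq_of_involutive {α : Type*} {f : α → α} {A : Set α} (hf : Function.Involutive f)
    (h : ∀ q ∈ A, f q ∈ A) : f '' A = A := by
  apply Set.Subset.antisymm
  · rintro _ ⟨q, hq, rfl⟩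
    exact h q hq
  · exact fun q hq => ⟨f q, h q hq, hf q⟩

/-! ### Cylindrical coordinates at a point of the helix -/

/-- The angle of the `t`-th point of the helix. -/
noncomputable def siteAngle (N : ℕ) (t : ℤ) : ℝ := 2 * Real.pi * t / N

/-- The coordinate along the axis of the helix, measured from the `t`-th site. -/
noncomputable def axial (N : ℕ) (t : ℤ) (q : E3) : ℝ := q 0 - siteAngle N t

/-- The coordinate in the direction from the axis to the `t`-th site. -/
noncomputable def radial (N : ℕ) (t : ℤ) (q : E3) : ℝ :=
  q 1 * Real.cos (siteAngle N t) + q 2 * Real.sin (siteAngle N t)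

/-- The coordinate orthogonal to the axis and to the radial direction at the `t`-th site. -/
noncomputable def tangential (N : ℕ) (t : ℤ) (q : E3) : ℝ :=
  q 2 * Real.cos (siteAngle N t) - q 1 * Real.sin (siteAngle N t)

theorem siteAngle_add (N : ℕ) (s t : ℤ) : siteAngle N (s + t) = siteAngle N s + siteAngle N t := by
  simp only [siteAngle]; push_cast; ring

theorem siteAngle_neg (N : ℕ) (t : ℤ) : siteAngle N (-t) = -siteAngle N t := by
  simp only [siteAngle]; push_cast; ring

theorem continuous_axial (N : ℕ) (t : ℤ) : Continuous (axial N t) := by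
  unfold axial; fun_prop

theorem continuous_radial (N : ℕ) (t : ℤ) : Continuous (radial N t) := by
  unfold radial; fun_prop

theorem continuous_tangential (N : ℕ) (t : ℤ) : Continuous (tangential N t) := by
  unfold tangential; fun_prop

theorem dist_sq_E3 (p q : E3) :
    dist p q ^ 2 = (p 0 - q 0) ^ 2 + (p 1 - q 1) ^ 2 + (p 2 - q 2) ^ 2 := by
  rw [EuclideanSpace.dist_eq, Real.sq_sqrt (by positivity), Fin.sum_univ_three]
  simp only [Real.dist_eq, sq_abs]

theorem radialDir_eq (N : ℕ) (t : ℤ) :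
    radialDir N t = !₂[0, Real.cos (siteAngle N t), Real.sin (siteAngle N t)] := rfl

theorem helixPoint_eq (N : ℕ) (t : ℤ) : helixPoint N t = helix (siteAngle N t) := rfl

/-- The excess of the squared distance to the `t`-th site over that to the `t + j`-th one, up to
the constant `siteAngle N j ^ 2`, in the coordinates at the `t`-th site. -/
noncomputable def siteForm (N : ℕ) (j : ℤ) (x y z : ℝ) : ℝ :=
  2 * (x * siteAngle N j + y * (Real.cos (siteAngle N j) - 1) + z * Real.sin (siteAngle N j))

theorem dist_sq_sub_dist_sq_helixPoint (N : ℕ) (t j : ℤ) (q : E3) :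
    dist q (helixPoint N t) ^ 2 - dist q (helixPoint N (t + j)) ^ 2 =
      siteForm N j (axial N t q) (radial N t q) (tangential N t q) - siteAngle N j ^ 2 := by
  have h1 := Real.sin_sq_add_cos_sq (siteAngle N t)
  have h2 := Real.sin_sq_add_cos_sq (siteAngle N t + siteAngle N j)
  simp only [dist_sq_E3, helixPoint_eq, helix, siteAngle_add, siteForm, axial, radial, tangential]
  simp
  have h3 := Real.cos_add (siteAngle N t) (siteAngle N j)
  have h4 := Real.sin_add (siteAngle N t) (siteAngle N j)
  linear_combination h1 - h2 + 2 * q 1 * h3 + 2 * q 2 * h4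

theorem dist_helixPoint_le_iff (N : ℕ) (t j : ℤ) (q : E3) :
    dist q (helixPoint N t) ≤ dist q (helixPoint N (t + j)) ↔
      siteForm N j (axial N t q) (radial N t q) (tangential N t q) ≤ siteAngle N j ^ 2 := by
  rw [dist_le_dist_iff_sq_sub_sq, dist_sq_sub_dist_sq_helixPoint, sub_nonpos]

theorem dist_helixPoint_lt_iff (N : ℕ) (t j : ℤ) (q : E3) :
    dist q (helixPoint N t) < dist q (helixPoint N (t + j)) ↔
      siteForm N j (axial N t q) (radial N t q) (tangential N t q) < siteAngle N j ^ 2 := by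
  rw [← sq_lt_sq₀ dist_nonneg dist_nonneg, ← sub_neg, dist_sq_sub_dist_sq_helixPoint, sub_neg]

/-- The Voronoi region of a site, in the coordinates at that site. -/
def InCell (N : ℕ) (x y z : ℝ) : Prop := ∀ j : ℤ, siteForm N j x y z ≤ siteAngle N j ^ 2

theorem mem_helixRegion_iff (N : ℕ) (t : ℤ) (q : E3) :
    q ∈ helixRegion N t ↔ InCell N (axial N t q) (radial N t q) (tangential N t q) := by
  simp only [helixRegion, voronoiRegion, Set.mem_ofPred_eq, Set.forall_mem_range, InCell,
    ← dist_helixPoint_le_iff]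
  exact ⟨fun h j => h _, fun h k => by simpa using h (k - t)⟩

/-- The coefficient of `y` is a multiple of `cos - 1`: all sites are equally far from the axis, so
none lies further than the `t`-th in its own radial direction. -/
theorem siteForm_anti (N : ℕ) (j : ℤ) (x z : ℝ) {y y' : ℝ} (h : y ≤ y') :
    siteForm N j x y' z ≤ siteForm N j x y z := by
  have := Real.cos_le_one (siteAngle N j)
  unfold siteForm
  nlinarith

theorem InCell.mono {N : ℕ} {x y y' z : ℝ} (h : InCell N x y z) (hy : y ≤ y') :
    InCell N x y' z :=
  fun j => (siteForm_anti N j x z hy).trans (h j)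

/-- The half-turn about the radial line through the `t`-th site swaps the sites `t + j` and `t - j`.
-/
theorem InCell.neg {N : ℕ} {x y z : ℝ} (h : InCell N x y z) : InCell N (-x) y (-z) := by
  intro j
  have := h (-j)
  simp only [siteForm, siteAngle_neg, Real.cos_neg, Real.sin_neg] at this ⊢
  linarith

/-- On a bounded box the form grows at most linearly in the site angle, and the right side
quadratically, so distant sites impose no constraint. -/
theorem siteForm_lt_of_abs_le {N : ℕ} {j : ℤ} {x y z R : ℝ} (hx : |x| ≤ R) (hy : |y| ≤ R)
    (hz : |z| ≤ R) (h : 2 * R + 4 ≤ |siteAngle N j|) : siteForm N j x y z < siteAngle N j ^ 2 := by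
  set u := siteAngle N j with hu
  have hR : 0 ≤ R := (abs_nonneg x).trans hx
  have h1 : x * u ≤ R * |u| := (le_abs_self _).trans (by rw [abs_mul]; gcongr)
  have h2 : y * (Real.cos u - 1) ≤ R * 2 := by
    refine (le_abs_self _).trans ?_
    rw [abs_mul]
    have : |Real.cos u - 1| ≤ 2 := by
      rw [abs_le]
      constructor <;> linarith [Real.cos_le_one u, Real.neg_one_le_cos u]
    gcongr
  have h3 : z * Real.sin u ≤ R * 1 := by
    refine (le_abs_self _).trans ?_
    rw [abs_mul]
    exact mul_le_mul hz (Real.abs_sin_le_one u) (abs_nonneg _) hR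
  rw [siteForm, ← hu, ← sq_abs u]
  nlinarith

theorem finite_abs_siteAngle_lt {N : ℕ} (hN : 3 ≤ N) (R : ℝ) :
    {j : ℤ | |siteAngle N j| < R}.Finite := by
  have hN0 : (0 : ℝ) < N := by positivity
  refine (Set.finite_Icc (-⌈R * N⌉) ⌈R * N⌉).subset fun j hj => ?_
  rw [Set.mem_ofPred_eq, siteAngle, abs_div, abs_mul, abs_mul, Nat.abs_cast, abs_two,
    abs_of_pos Real.pi_pos, div_lt_iff₀ hN0] at hj
  have hp := Real.pi_gt_three
  have h1 : |(j : ℝ)| ≤ (⌈R * N⌉ : ℤ) := by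
    refine le_trans ?_ (Int.le_ceil _)
    nlinarith [abs_nonneg (j : ℝ)]
  rw [Set.mem_Icc, ← abs_le]
  exact_mod_cast h1

/-- Strict closeness to the `t`-th site persists nearby, even for infinitely many sites. -/
theorem eventually_forall_dist_helixPoint_lt {N : ℕ} (hN : 3 ≤ N) (t : ℤ) (p : E3) (S : Set ℤ)
    (h : ∀ j ∈ S, dist p (helixPoint N t) < dist p (helixPoint N (t + j))) :
    ∀ᶠ q in nhds p, ∀ j ∈ S, dist q (helixPoint N t) < dist q (helixPoint N (t + j)) := by
  obtain ⟨R, hR⟩ : ∃ R, |axial N t p| < R ∧ |radial N t p| < R ∧ |tangential N t p| < R :=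
    ⟨|axial N t p| + |radial N t p| + |tangential N t p| + 1, by
      have h1 := abs_nonneg (axial N t p)
      have h2 := abs_nonneg (radial N t p)
      have h3 := abs_nonneg (tangential N t p)
      refine ⟨?_, ?_, ?_⟩ <;> linarith⟩
  have hx := (continuous_axial N t).abs.continuousAt.eventually_lt_const hR.1
  have hy := (continuous_radial N t).abs.continuousAt.eventually_lt_const hR.2.1
  have hz := (continuous_tangential N t).abs.continuousAt.eventually_lt_const hR.2.2
  have hfin : ∀ᶠ q in nhds p, ∀ j ∈ {j | |siteAngle N j| < 2 * R + 4} ∩ S,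
      dist q (helixPoint N t) < dist q (helixPoint N (t + j)) := by
    rw [Filter.eventually_all_finite ((finite_abs_siteAngle_lt hN _).inter_of_left _)]
    intro j hj
    have hc : ContinuousAt
        (fun q : E3 => dist q (helixPoint N t) - dist q (helixPoint N (t + j))) p := by
      fun_prop
    filter_upwards [hc.eventually_lt_const (u := 0) (sub_neg.2 (h j hj.2))] with q hq
    exact sub_neg.1 hq
  filter_upwards [hx, hy, hz, hfin] with q hqx hqy hqz hq j hj
  rcases lt_or_ge |siteAngle N j| (2 * R + 4) with h' | h'
  · exact hq j ⟨h', hj⟩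
  · rw [dist_helixPoint_lt_iff]
    exact siteForm_lt_of_abs_le hqx.le hqy.le hqz.le h'

/-! ### The doubled regions -/

theorem mem_clippingHalfspace_iff (N : ℕ) (t : ℤ) (q : E3) :
    q ∈ clippingHalfspace N t ↔ radial N t q ≤ N := Iff.rfl

theorem inner_radialDir (N : ℕ) (t : ℤ) (q : E3) : inner ℝ (radialDir N t) q = radial N t q := by
  simp [radialDir_eq, PiLp.inner_apply, Fin.sum_univ_three, radial]

theorem inner_radialDir_self (N : ℕ) (t : ℤ) :
    inner ℝ (radialDir N t) (radialDir N t) = (1 : ℝ) := by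
  rw [inner_radialDir]
  simp [radial, radialDir_eq, ← sq]

theorem radialDir_ne_zero (N : ℕ) (t : ℤ) : radialDir N t ≠ 0 := by
  intro h
  have := inner_radialDir_self N t
  simp [h] at this

theorem axial_add_smul (N : ℕ) (t : ℤ) (q : E3) (c : ℝ) :
    axial N t (q + c • radialDir N t) = axial N t q := by
  simp [axial, radialDir_eq]

theorem radial_add_smul (N : ℕ) (t : ℤ) (q : E3) (c : ℝ) :
    radial N t (q + c • radialDir N t) = radial N t q + c := by
  rw [← inner_radialDir, ← inner_radialDir, inner_add_right, inner_smul_right,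
    inner_radialDir_self, mul_one]

theorem tangential_add_smul (N : ℕ) (t : ℤ) (q : E3) (c : ℝ) :
    tangential N t (q + c • radialDir N t) = tangential N t q := by
  simp [tangential, radialDir_eq]
  ring

theorem reflection_clippingPlane (N : ℕ) (t : ℤ) (q : E3) :
    EuclideanGeometry.reflection (clippingPlane N t) q =
      q + (2 * (N - radial N t q)) • radialDir N t := by
  rw [reflection_eq_of_midpoint (m := q + (N - radial N t q) • radialDir N t)]
  · module
  · rw [mem_clippingPlane_iff]
    change radial N t _ = N
    rw [radial_add_smul]
    ring
  · rw [clippingPlane, AffineSubspace.direction_mk']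
    apply Submodule.le_orthogonal_orthogonal
    rw [sub_add_cancel_left]
    exact neg_mem (Submodule.smul_mem _ _ (Submodule.mem_span_singleton_self _))

theorem axial_reflection (N : ℕ) (t : ℤ) (q : E3) :
    axial N t (EuclideanGeometry.reflection (clippingPlane N t) q) = axial N t q := by
  rw [reflection_clippingPlane, axial_add_smul]

theorem radial_reflection (N : ℕ) (t : ℤ) (q : E3) :
    radial N t (EuclideanGeometry.reflection (clippingPlane N t) q) = 2 * N - radial N t q := by
  rw [reflection_clippingPlane, radial_add_smul]
  ring

theorem tangential_reflection (N : ℕ) (t : ℤ) (q : E3) :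
    tangential N t (EuclideanGeometry.reflection (clippingPlane N t) q) = tangential N t q := by
  rw [reflection_clippingPlane, tangential_add_smul]

theorem mem_clippedRegion_iff (N : ℕ) (t : ℤ) (q : E3) : q ∈ clippedRegion N t ↔
    InCell N (axial N t q) (radial N t q) (tangential N t q) ∧ radial N t q ≤ N := by
  rw [clippedRegion, Set.mem_inter_iff, mem_helixRegion_iff, mem_clippingHalfspace_iff]

/-- Below the clipping plane the mirror image of a point lies further out radially, so `InCell.mono`
supplies the second condition from the first; above it the roles are exchanged. -/
theorem mem_doubledRegion_iff (N : ℕ) (t : ℤ) (q : E3) : q ∈ doubledRegion N t ↔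
    InCell N (axial N t q) (radial N t q) (tangential N t q) ∧
      InCell N (axial N t q) (2 * N - radial N t q) (tangential N t q) := by
  rw [doubledRegion, Set.mem_union]
  constructor
  · rintro (h | ⟨p, h, rfl⟩)
    · rw [mem_clippedRegion_iff] at h
      exact ⟨h.1, h.1.mono (by linarith)⟩
    · rw [mem_clippedRegion_iff] at h
      rw [axial_reflection, radial_reflection, tangential_reflection, sub_sub_cancel]
      exact ⟨h.1.mono (by linarith), h.1⟩
  · rintro ⟨h1, h2⟩
    rcases le_total (radial N t q) N with h | h
    · exact Or.inl ((mem_clippedRegion_iff N t q).2 ⟨h1, h⟩)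
    · refine Or.inr ⟨EuclideanGeometry.reflection (clippingPlane N t) q, ?_,
        EuclideanGeometry.reflection_reflection _ _⟩
      rw [mem_clippedRegion_iff, axial_reflection, radial_reflection, tangential_reflection]
      exact ⟨h2, by linarith⟩

theorem doubledRegion_subset_helixRegion (N : ℕ) (t : ℤ) :
    doubledRegion N t ⊆ helixRegion N t := fun q hq =>
  (mem_helixRegion_iff N t q).2 ((mem_doubledRegion_iff N t q).1 hq).1

theorem dist_le_of_mem_helixRegion {N : ℕ} {t : ℤ} {q : E3} (h : q ∈ helixRegion N t) (k : ℤ) :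
    dist q (helixPoint N t) ≤ dist q (helixPoint N k) := h _ ⟨k, rfl⟩

/-! ### The doubled regions are polytopes -/

theorem siteAngle_self {N : ℕ} (hN : 3 ≤ N) : siteAngle N N = 2 * Real.pi := by
  have hN0 : (0 : ℝ) < N := by positivity
  rw [siteAngle, Int.cast_natCast]
  field_simp

theorem siteAngle_one_pos {N : ℕ} (hN : 3 ≤ N) : 0 < siteAngle N 1 := by
  have hN0 : (0 : ℝ) < N := by positivity
  have := Real.pi_pos
  rw [siteAngle, Int.cast_one]
  positivity

theorem siteAngle_one_lt_pi {N : ℕ} (hN : 3 ≤ N) : siteAngle N 1 < Real.pi := by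
  have hN0 : (3 : ℝ) ≤ N := by exact_mod_cast hN
  have := Real.pi_pos
  rw [siteAngle, Int.cast_one, div_lt_iff₀ (by linarith)]
  nlinarith

/-- Four of the sites suffice to bound a doubled region. -/
theorem exists_bound_of_siteForm_le {N : ℕ} (hN : 3 ≤ N) : ∃ R : ℝ, ∀ x y z : ℝ,
    (∀ j ∈ ({1, -1, (N : ℤ), -(N : ℤ)} : Set ℤ), siteForm N j x y z ≤ siteAngle N j ^ 2 ∧
      siteForm N j x (2 * N - y) z ≤ siteAngle N j ^ 2) → |x| ≤ R ∧ |y| ≤ R ∧ |z| ≤ R := by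
  have hN0 : (0 : ℝ) < N := by positivity
  have hp := Real.pi_pos
  have hθ := siteAngle_one_pos hN
  have hs := Real.sin_pos_of_pos_of_lt_pi hθ (siteAngle_one_lt_pi hN)
  set θ := siteAngle N 1 with hθdef
  have hc : 0 < 1 - Real.cos θ := by
    have := Real.sin_sq_add_cos_sq θ
    have h1 := Real.cos_le_one θ
    by_contra h
    have : Real.cos θ = 1 := by linarith
    nlinarith
  have hc2 : 1 - Real.cos θ ≤ 2 := by linarith [Real.neg_one_le_cos θ]
  -- Adding the constraints for `j = 1` and `j = -1` cancels `x` and `z` and leaves `y ≥ -B`; their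
  -- mirror images give `y ≤ 2N + B`. The sites `±N`, one full turn away, give `|x| ≤ π`, and `Z`
  -- then bounds `z`.
  set B := θ ^ 2 / (2 * (1 - Real.cos θ)) with hB
  have hB0 : 0 ≤ B := by positivity
  have hBmul : B * (2 * (1 - Real.cos θ)) = θ ^ 2 := by rw [hB]; field_simp
  set Z := (θ ^ 2 + 2 * Real.pi * θ + 4 * (2 * N + B)) / (2 * Real.sin θ) with hZ
  have hZ0 : 0 ≤ Z := by positivity
  have hZmul : Z * (2 * Real.sin θ) = θ ^ 2 + 2 * Real.pi * θ + 4 * (2 * N + B) := by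
    rw [hZ]; field_simp
  refine ⟨Real.pi + (2 * N + B) + Z, fun x y z h => ?_⟩
  have h1 := h 1 (by simp)
  have h2 := h (-1) (by simp)
  have h3 := (h N (by simp)).1
  have h4 := (h (-N) (by simp)).1
  simp only [siteForm, siteAngle_neg, siteAngle_self hN, ← hθdef, Real.cos_neg, Real.sin_neg,
    Real.cos_two_pi, Real.sin_two_pi] at h1 h2 h3 h4
  have hx : |x| ≤ Real.pi := by
    rw [abs_le]
    constructor <;> nlinarith
  have hx' := abs_le.1 hx
  have hy1 : -B ≤ y := by
    by_contra! hlt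
    nlinarith
  have hy2 : y ≤ 2 * N + B := by
    by_contra! hlt
    nlinarith
  have hyc : y * (1 - Real.cos θ) ≤ (2 * N + B) * 2 := by
    calc y * (1 - Real.cos θ) ≤ (2 * N + B) * (1 - Real.cos θ) := by gcongr
      _ ≤ _ := by gcongr
  have hz : |z| ≤ Z := by
    rw [abs_le]
    constructor
    · by_contra! hlt
      nlinarith
    · by_contra! hlt
      nlinarith
  exact ⟨by linarith, by rw [abs_le]; constructor <;> linarith, by linarith⟩

theorem dist_sq_helixPoint (N : ℕ) (t : ℤ) (q : E3) : dist q (helixPoint N t) ^ 2 =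
    axial N t q ^ 2 + (radial N t q - 1) ^ 2 + tangential N t q ^ 2 := by
  have h1 := Real.sin_sq_add_cos_sq (siteAngle N t)
  simp only [dist_sq_E3, helixPoint_eq, helix, axial, radial, tangential]
  simp
  linear_combination (1 - q 1 ^ 2 - q 2 ^ 2) * h1

theorem exists_finite_doubledRegion_eq {N : ℕ} (hN : 3 ≤ N) (t : ℤ) :
    ∃ T : Set (E3 × E3), T.Finite ∧ Bornology.IsBounded (closerSet T) ∧
      doubledRegion N t = closerSet T := by
  obtain ⟨R, hR⟩ := exists_bound_of_siteForm_le hN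
  set J : Set ℤ := {j | |siteAngle N j| < 2 * R + 4} ∪ {1, -1, (N : ℤ), -(N : ℤ)} with hJ
  have hJfin : J.Finite := (finite_abs_siteAngle_lt hN _).union (Set.toFinite _)
  set ρ := EuclideanGeometry.reflection (clippingPlane N t) with hρ
  -- The pairs of reflected sites cut out the mirror image of the cell.
  set T : Set (E3 × E3) := (fun j => (helixPoint N t, helixPoint N (t + j))) '' J ∪
    (fun j => (ρ (helixPoint N t), ρ (helixPoint N (t + j)))) '' J with hT
  have hmem (q : E3) : q ∈ closerSet T ↔ ∀ j ∈ J,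
      siteForm N j (axial N t q) (radial N t q) (tangential N t q) ≤ siteAngle N j ^ 2 ∧
      siteForm N j (axial N t q) (2 * N - radial N t q) (tangential N t q) ≤
        siteAngle N j ^ 2 := by
    have hd (a : E3) : dist q (ρ a) = dist (ρ q) a := by
      rw [← ρ.dist_map q, EuclideanGeometry.reflection_reflection]
    have h2 (j : ℤ) := dist_helixPoint_le_iff N t j (ρ q)
    simp only [hρ, axial_reflection, radial_reflection, tangential_reflection] at h2
    simp only [← hρ] at h2
    simp only [closerSet, hT, Set.mem_ofPred_eq, Set.mem_union, or_imp, forall_and,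
      Set.forall_mem_image, hd, h2, dist_helixPoint_le_iff]
  have hbd (q : E3) (hq : q ∈ closerSet T) :
      |axial N t q| ≤ R ∧ |radial N t q| ≤ R ∧ |tangential N t q| ≤ R :=
    hR _ _ _ fun j hj => (hmem q).1 hq j (Or.inr hj)
  refine ⟨T, (hJfin.image _).union (hJfin.image _), ?_, ?_⟩
  · refine (Metric.isBounded_closedBall (x := helixPoint N t) (r := 3 * R + 1)).subset ?_
    intro q hq
    obtain ⟨hx, hy, hz⟩ := hbd q hq
    have hR0 : 0 ≤ R := (abs_nonneg _).trans hx
    rw [Metric.mem_closedBall, ← sq_le_sq₀ dist_nonneg (by linarith), dist_sq_helixPoint]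
    rw [abs_le] at hx hy hz
    nlinarith
  · ext q
    rw [mem_doubledRegion_iff]
    constructor
    · exact fun h => (hmem q).2 fun j _ => ⟨h.1 j, h.2 j⟩
    · intro hq
      have hall (j : ℤ) : siteForm N j (axial N t q) (radial N t q) (tangential N t q) ≤
            siteAngle N j ^ 2 ∧ siteForm N j (axial N t q) (2 * N - radial N t q)
            (tangential N t q) ≤ siteAngle N j ^ 2 := by
        by_cases hj : j ∈ J
        · exact (hmem q).1 hq j hj
        · have hj' : 2 * R + 4 ≤ |siteAngle N j| := by
            by_contra! h
            exact hj (Or.inl h)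
          obtain ⟨hx, hy, hz⟩ := hbd q hq
          have h1 := siteForm_lt_of_abs_le hx hy hz hj'
          refine ⟨h1.le, ?_⟩
          have hy' : |2 * N - radial N t q| ≤ R :=
            (hR _ (2 * N - radial N t q) _ fun i hi => by
              have := (hmem q).1 hq i (Or.inr hi)
              rw [sub_sub_cancel]
              exact this.symm).2.1
          exact (siteForm_lt_of_abs_le hx hy' hz hj').le
      exact ⟨fun j => (hall j).1, fun j => (hall j).2⟩

theorem helixPoint_ne_helixPoint_add {N : ℕ} (hN : 3 ≤ N) (t : ℤ) {j : ℤ} (hj : j ≠ 0) :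
    helixPoint N t ≠ helixPoint N (t + j) := by
  intro h
  have hN0 : (0 : ℝ) < N := by positivity
  have h0 := congrArg (fun q : E3 => q 0) h
  simp only [helixPoint_eq, helix, siteAngle_add] at h0
  have hj0 : (j : ℝ) ≠ 0 := by exact_mod_cast hj
  have : siteAngle N j = 0 := by simpa using h0
  have hp := Real.pi_ne_zero
  simp [siteAngle, hj0, hp, hN0.ne'] at this

/-- Strictly inside the halfspace the clipping is locally invisible, so local questions reduce to
the Voronoi region. -/
theorem eventually_mem_doubledRegion {N : ℕ} {t : ℤ} {p : E3} (hp : radial N t p < N) :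
    ∀ᶠ q in nhds p, q ∈ helixRegion N t → q ∈ doubledRegion N t := by
  filter_upwards [(continuous_radial N t).continuousAt.eventually_lt_const hp] with q hq hmem
  exact Or.inl ⟨hmem, hq.le⟩

theorem doubledRegion_mem_nhds {N : ℕ} (hN : 3 ≤ N) (t : ℤ) :
    doubledRegion N t ∈ nhds (helixPoint N t) := by
  have hN0 : (3 : ℝ) ≤ N := by exact_mod_cast hN
  have hr : radial N t (helixPoint N t) < N := by
    have : radial N t (helixPoint N t) = 1 := by
      simp [radial, helixPoint_eq, helix, ← sq]
    linarith
  filter_upwards [eventually_mem_doubledRegion hr,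
    eventually_forall_dist_helixPoint_lt hN t (helixPoint N t) {0}ᶜ fun j hj => by
      rw [dist_self]
      exact dist_pos.2 (helixPoint_ne_helixPoint_add hN t hj)] with q hq hlt
  apply hq
  rintro _ ⟨k, rfl⟩
  rcases eq_or_ne k t with rfl | hk
  · exact le_rfl
  · have := hlt (k - t) (sub_ne_zero.2 hk)
    rw [add_sub_cancel] at this
    exact this.le

theorem isConvexPolytope3_doubledRegion {N : ℕ} (hN : 3 ≤ N) (t : ℤ) :
    IsConvexPolytope3 (doubledRegion N t) := by
  obtain ⟨T, hT, hb, h⟩ := exists_finite_doubledRegion_eq hN t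
  refine ⟨?_, setDim_eq_three_of_mem_nhds (doubledRegion_mem_nhds hN t)⟩
  rw [h]
  exact exists_finset_closerSet_eq_convexHull hT hb

/-! ### Neighborliness -/

theorem setDim_doubledRegion_inter {N : ℕ} (hN : 3 ≤ N) (t : ℤ) {m : ℕ} (hm : 0 < m)
    (hmN : m ≤ N) : setDim (doubledRegion N t ∩ doubledRegion N (t + m)) = 2 := by
  have hN0 : (0 : ℝ) < N := by positivity
  obtain ⟨r, hclip, hgap⟩ := exists_radius_gap hN hm hmN
  set α := Real.pi * m / N with hα
  set c := siteAngle N t + α with hc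
  -- This is the point at the middle angle `c`, at distance `|r|` from the axis, with `r` from
  -- `exists_radius_gap`.
  set p : E3 := !₂[c, -r * Real.cos c, -r * Real.sin c] with hp
  have hdist (j : ℤ) : dist p (helixPoint N (t + j)) ^ 2 =
      (α - 2 * Real.pi * j / N) ^ 2 + 2 * r * Real.cos (α - 2 * Real.pi * j / N) + 1 + r ^ 2 := by
    have e : α - 2 * Real.pi * j / N = c - siteAngle N (t + j) := by
      rw [siteAngle_add, hc, siteAngle, siteAngle]; ring
    rw [e, Real.cos_sub, dist_sq_E3, helixPoint_eq, helix, hp]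
    simp
    linear_combination Real.sin_sq_add_cos_sq (siteAngle N (t + j)) +
      r ^ 2 * Real.sin_sq_add_cos_sq c
  have hrad (j : ℤ) : radial N (t + j) p = -r * Real.cos (α - 2 * Real.pi * j / N) := by
    have e : α - 2 * Real.pi * j / N = c - siteAngle N (t + j) := by
      rw [siteAngle_add, hc, siteAngle, siteAngle]; ring
    rw [e, Real.cos_sub, radial, hp]
    simp
    ring
  have hm2 : α - 2 * Real.pi * (m : ℤ) / N = -α := by rw [hα]; push_cast; ring
  have hs : radial N t p < N := by
    have := hrad 0
    simp only [add_zero, Int.cast_zero, mul_zero, zero_div, sub_zero] at this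
    rwa [this]
  have ht : radial N (t + m) p < N := by
    rwa [hrad, hm2, Real.cos_neg]
  have hd0 : dist p (helixPoint N t) ^ 2 = α ^ 2 + 2 * r * Real.cos α + 1 + r ^ 2 := by
    simpa using hdist 0
  have heq : dist p (helixPoint N t) = dist p (helixPoint N (t + m)) := by
    rw [← sq_eq_sq₀ dist_nonneg dist_nonneg, hd0, hdist, hm2, Real.cos_neg, neg_sq]
  have hlt : ∀ j ∈ ({0, (m : ℤ)}ᶜ : Set ℤ),
      dist p (helixPoint N t) < dist p (helixPoint N (t + j)) := by
    intro j hj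
    simp only [Set.mem_compl_iff, Set.mem_insert_iff, Set.mem_singleton_iff, not_or] at hj
    rw [← sq_lt_sq₀ dist_nonneg dist_nonneg, hd0, hdist]
    linarith [hgap j hj.1 hj.2]
  refine setDim_eq_two_of_perpBisector (p := p)
    (helixPoint_ne_helixPoint_add hN t (j := m) (by exact_mod_cast hm.ne')) ?_ heq ?_
  · rintro q ⟨h1, h2⟩
    exact le_antisymm (dist_le_of_mem_helixRegion (doubledRegion_subset_helixRegion N _ h1) _)
      (dist_le_of_mem_helixRegion (doubledRegion_subset_helixRegion N _ h2) _)
  · filter_upwards [eventually_mem_doubledRegion hs, eventually_mem_doubledRegion ht,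
      eventually_forall_dist_helixPoint_lt hN t p _ hlt] with q hqs hqt hq hqeq
    have hV (k : ℤ) : dist q (helixPoint N t) ≤ dist q (helixPoint N k) := by
      rcases eq_or_ne k t with rfl | h1
      · exact le_rfl
      rcases eq_or_ne k (t + m) with rfl | h2
      · exact hqeq.le
      have := hq (k - t) (by
        simp only [Set.mem_compl_iff, Set.mem_insert_iff, Set.mem_singleton_iff, not_or]
        exact ⟨sub_ne_zero.2 h1, fun h => h2 (by linarith)⟩)
      rw [add_sub_cancel] at this
      exact this.le
    refine ⟨hqs ?_, hqt ?_⟩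
    · rintro _ ⟨k, rfl⟩
      exact hV k
    · rintro _ ⟨k, rfl⟩
      rw [← hqeq]
      exact hV k

/-! ### Symmetries -/

theorem hasSymmetryPlane_doubledRegion (N : ℕ) (t : ℤ) :
    HasSymmetryPlane (doubledRegion N t) := by
  refine ⟨clippingPlane N t, inferInstance, ?_, ?_⟩
  · have : Fact (finrank ℝ E3 = 2 + 1) := ⟨by simp⟩
    rw [clippingPlane, AffineSubspace.direction_mk']
    exact Submodule.finrank_orthogonal_span_singleton (n := 2) (radialDir_ne_zero N t)
  · refine image_eq_of_involutive (EuclideanGeometry.reflection_involutive _) fun q hq => ?_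
    rw [mem_doubledRegion_iff] at hq ⊢
    rw [axial_reflection, radial_reflection, tangential_reflection, sub_sub_cancel]
    exact hq.symm

/-- The point of the axis of the helix nearest to the `t`-th site. -/
noncomputable def axisPoint (N : ℕ) (t : ℤ) : E3 := !₂[siteAngle N t, 0, 0]

theorem axial_pointReflection (N : ℕ) (t : ℤ) (c : ℝ) (q : E3) :
    axial N t ((2 : ℝ) • (axisPoint N t + c • radialDir N t) - q) = -axial N t q := by
  simp [axial, axisPoint, radialDir_eq]
  ring

theorem radial_pointReflection (N : ℕ) (t : ℤ) (c : ℝ) (q : E3) :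
    radial N t ((2 : ℝ) • (axisPoint N t + c • radialDir N t) - q) = 2 * c - radial N t q := by
  simp [radial, axisPoint, radialDir_eq]
  linear_combination 2 * c * Real.cos_sq_add_sin_sq (siteAngle N t)

theorem tangential_pointReflection (N : ℕ) (t : ℤ) (c : ℝ) (q : E3) :
    tangential N t ((2 : ℝ) • (axisPoint N t + c • radialDir N t) - q) = -tangential N t q := by
  simp [tangential, axisPoint, radialDir_eq]
  ring

theorem hasHalfTurnAxis_doubledRegion (N : ℕ) (t : ℤ) :
    HasHalfTurnAxis (doubledRegion N t) := by
  let L := AffineSubspace.mk' (axisPoint N t) (Submodule.span ℝ {radialDir N t})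
  have hL : Nonempty L := inferInstanceAs (Nonempty (AffineSubspace.mk' _ _))
  refine ⟨L, hL, ?_, ?_⟩
  · rw [AffineSubspace.direction_mk']
    exact finrank_span_singleton (radialDir_ne_zero N t)
  · refine image_eq_of_involutive (EuclideanGeometry.reflection_involutive _) fun q hq => ?_
    -- The foot of the perpendicular from `q` to `L` has radial coordinate that of `q`, so the
    -- half-turn acts on `q` as the reflection in that foot.
    have hq' : EuclideanGeometry.reflection L q =
        (2 : ℝ) • (axisPoint N t + radial N t q • radialDir N t) - q := by
      rw [reflection_eq_of_midpoint (m := axisPoint N t + radial N t q • radialDir N t), two_smul]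
      · rw [AffineSubspace.mem_mk', vsub_eq_sub, add_sub_cancel_left]
        exact Submodule.smul_mem _ _ (Submodule.mem_span_singleton_self _)
      · rw [AffineSubspace.direction_mk', Submodule.mem_orthogonal_singleton_iff_inner_right,
          inner_sub_right, inner_add_right, inner_smul_right, inner_radialDir_self,
          inner_radialDir, inner_radialDir]
        simp [radial, axisPoint]
    rw [mem_doubledRegion_iff] at hq ⊢
    rw [hq', axial_pointReflection, radial_pointReflection, tangential_pointReflection,
      show 2 * radial N t q - radial N t q = radial N t q by ring]
    exact ⟨hq.1.neg, hq.2.neg⟩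

/-- The half-turn axis meets the clipping plane at right angles in this center; the composite of the
two symmetries is the point reflection, which exchanges the two cell conditions. -/
theorem hasSymmetryCenter_doubledRegion (N : ℕ) (t : ℤ) :
    HasSymmetryCenter (doubledRegion N t) := by
  refine ⟨axisPoint N t + (N : ℝ) • radialDir N t, image_eq_of_involutive
    (AffineIsometryEquiv.pointReflection_involutive _) fun q hq => ?_⟩
  have hq' : AffineIsometryEquiv.pointReflection ℝ (axisPoint N t + (N : ℝ) • radialDir N t) q =
      (2 : ℝ) • (axisPoint N t + (N : ℝ) • radialDir N t) - q := by
    rw [AffineIsometryEquiv.pointReflection_apply, vsub_eq_sub, vadd_eq_add]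
    module
  rw [mem_doubledRegion_iff] at hq ⊢
  rw [hq', axial_pointReflection, radial_pointReflection, tangential_pointReflection,
    sub_sub_cancel]
  exact ⟨hq.2.neg, hq.1.neg⟩

/-! ### Congruence -/

/-- The screw motion by the angle `d`. -/
noncomputable def screw (d : ℝ) (q : E3) : E3 :=
  !₂[q 0 + d, q 1 * Real.cos d - q 2 * Real.sin d, q 1 * Real.sin d + q 2 * Real.cos d]

theorem isometry_screw (d : ℝ) : Isometry (screw d) := by
  refine Isometry.of_dist_eq fun p q => ?_
  rw [← sq_eq_sq₀ dist_nonneg dist_nonneg, dist_sq_E3, dist_sq_E3, screw, screw]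
  simp
  linear_combination ((p 1 - q 1) ^ 2 + (p 2 - q 2) ^ 2) * Real.sin_sq_add_cos_sq d

theorem screw_screw_neg (d : ℝ) (q : E3) : screw d (screw (-d) q) = q := by
  have h := Real.sin_sq_add_cos_sq d
  ext i
  fin_cases i
  · simp [screw]
  · simp [screw]
    linear_combination q 1 * h
  · simp [screw]
    linear_combination q 2 * h

/-- The screw motion by the difference of the site angles carries the coordinates at one site to
those at the other, and membership depends only on these coordinates. -/
theorem areCongruent_doubledRegion (N : ℕ) (s t : ℤ) :
    AreCongruent (doubledRegion N s) (doubledRegion N t) := by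
  set d := siteAngle N t - siteAngle N s with hd
  have ht : siteAngle N t = siteAngle N s + d := by ring
  have hsq := Real.sin_sq_add_cos_sq d
  have hx (q : E3) : axial N t (screw d q) = axial N s q := by
    simp [axial, screw, ht]
  have hy (q : E3) : radial N t (screw d q) = radial N s q := by
    simp [radial, screw, ht, Real.cos_add, Real.sin_add]
    linear_combination (q 1 * Real.cos (siteAngle N s) + q 2 * Real.sin (siteAngle N s)) * hsq
  have hz (q : E3) : tangential N t (screw d q) = tangential N s q := by
    simp [tangential, screw, ht, Real.cos_add, Real.sin_add]
    linear_combination (q 2 * Real.cos (siteAngle N s) - q 1 * Real.sin (siteAngle N s)) * hsq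
  have hmem (q : E3) : screw d q ∈ doubledRegion N t ↔ q ∈ doubledRegion N s := by
    rw [mem_doubledRegion_iff, mem_doubledRegion_iff, hx, hy, hz]
  let g : E3 ≃ᵢ E3 := IsometryEquiv.mk' (screw d) (screw (-d)) (screw_screw_neg d) (isometry_screw d)
  refine ⟨g.toRealAffineIsometryEquiv, ?_⟩
  ext q
  rw [IsometryEquiv.coeFn_toRealAffineIsometryEquiv]
  constructor
  · rintro ⟨p, hp, rfl⟩
    exact (hmem p).2 hp
  · intro hq
    refine ⟨screw (-d) q, ?_, screw_screw_neg d q⟩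
    rwa [← hmem, screw_screw_neg]

theorem isSymmetricNeighborlyFamily_doubledRegion {N n : ℕ} (hN : 3 ≤ N) (hn : n ≤ N + 1) (a : ℤ) :
    IsSymmetricNeighborlyFamily (fun i : Fin n => doubledRegion N (a + (i : ℤ))) where
  polytope i := isConvexPolytope3_doubledRegion hN _
  neighborly := by
    have key (i j : Fin n) (hij : i < j) :
        setDim (doubledRegion N (a + (i : ℤ)) ∩ doubledRegion N (a + (j : ℤ))) = 2 := by
      have hij' : (i : ℕ) < j := hij
      -- Indices in `Fin n` differ by at most `n - 1 ≤ N`, the largest gap allowed.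
      have := setDim_doubledRegion_inter hN (a + (i : ℤ)) (m := (j : ℕ) - i) (by omega) (by omega)
      rwa [Nat.cast_sub hij'.le, add_assoc, add_sub_cancel] at this
    intro i j hij
    rcases lt_or_gt_of_ne hij with h | h
    · exact key i j h
    · rw [Set.inter_comm]
      exact key j i h
  congruent i j := areCongruent_doubledRegion N _ _
  plane i := hasSymmetryPlane_doubledRegion N _
  axis i := hasHalfTurnAxis_doubledRegion N _
  center i := hasSymmetryCenter_doubledRegion N _

theorem mainTheorem3 (n : ℕ) (hn : 0 < n) :
    (∃ P : Fin n → Set E3, IsSymmetricNeighborlyFamily P) ∧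
    (∀ N : ℕ, 3 ≤ N → n ≤ N + 1 → ∀ a : ℤ,
      IsSymmetricNeighborlyFamily (fun i : Fin n => doubledRegion N (a + (i : ℤ)))) :=
  ⟨⟨_, isSymmetricNeighborlyFamily_doubledRegion (N := n + 3) (by omega) (by omega) 0⟩,
    fun _ hN hnN a => isSymmetricNeighborlyFamily_doubledRegion hN hnN a⟩
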